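/- For complex $q$ with $|q|<1$ and $x\in\mathbb{C}\setminus\{0\}$ let $(x;q)_\infty=\prod_{i\ge 0}(1-q^i x)$ and $$j(x;q)=(x;q)_\infty\,(q/x;q)_\infty\,(q;q)_\infty,$$ and for integers $a,b,c$ let $$f_{a,b,c}(x,y;q)=\Big(\sum_{r,s\ge 0}-\sum_{r,s<0}\Big)(-1)^{r+s}x^r y^s q^{a\binom r2+brs+c\binom s2},\qquad \binom r2=\frac{r(r-1)}2 ,$$ where $r,s$ run over the integers, whenever both double series converge absolutely. Theorem. Let $q\in\mathbb{C}$ with $0<|q|<1$, and let $q^{1/2}$ be either square root of $q$. Then the two double series defining $f_{1,3,1}(q^2,q^2;q^4)$ converge absolutely, and $$f_{1,3,1}(q^2,q^2;q^4)=j(q^{1/2};-q)=j(-q^{1/2};-q)=j(q^2;q^4).$$ -/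

import Mathlib

noncomputable section

namespace HeckeDoubleSum

/-- The infinite `q`-Pochhammer symbol `(x; q)_∞ = ∏_{i ≥ 0} (1 - q ^ i * x)`. -/
def qPochInf (x q : ℂ) : ℂ := ∏' i : ℕ, (1 - q ^ i * x)

/-- The infinite product `(x; q)_∞` converges whenever `‖q‖ < 1`, so that `qPochInf` never takes a
default value there. -/
theorem multipliable_qPochInf (x : ℂ) {q : ℂ} (hq : ‖q‖ < 1) :
    Multipliable fun i : ℕ => 1 - q ^ i * x := by
  have h : Summable fun i : ℕ => ‖-(q ^ i * x)‖ := by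
    simp only [norm_neg, norm_mul, norm_pow]
    exact (summable_geometric_of_lt_one (norm_nonneg q) hq).mul_right _
  simpa [sub_eq_add_neg] using multipliable_one_add_of_summable h

/-- The theta function `j(x; q) = (x; q)_∞ (q / x; q)_∞ (q; q)_∞`. -/
def j (x q : ℂ) : ℂ := qPochInf x q * qPochInf (q / x) q * qPochInf q q

/-- The binomial coefficient `r (r - 1) / 2` of an arbitrary integer `r`. -/
def choose2 (r : ℤ) : ℤ := r * (r - 1) / 2

/-- The division in `choose2` is exact. -/
theorem two_mul_choose2 (r : ℤ) : 2 * choose2 r = r * (r - 1) :=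
  Int.mul_ediv_cancel' (even_iff_two_dvd.mp (Int.even_mul_pred_self r))

/-- The general term `(-1)^(r+s) x^r y^s q^(a r(r-1)/2 + b r s + c s(s-1)/2)`. -/
def term (a b c : ℤ) (x y q : ℂ) (p : ℤ × ℤ) : ℂ :=
  (-1) ^ (p.1 + p.2) * x ^ p.1 * y ^ p.2 * q ^ (a * choose2 p.1 + b * p.1 * p.2 + c * choose2 p.2)

/-- The index set `r, s ≥ 0`. -/
def nonnegQuadrant : Set (ℤ × ℤ) := {p | 0 ≤ p.1 ∧ 0 ≤ p.2}

/-- The index set `r, s < 0`. -/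
def negQuadrant : Set (ℤ × ℤ) := {p | p.1 < 0 ∧ p.2 < 0}

/-- Absolute convergence of the two double series that make up `f_{a,b,c}(x, y; q)`. -/
def Converges (a b c : ℤ) (x y q : ℂ) : Prop :=
  (Summable fun p : nonnegQuadrant => term a b c x y q p) ∧
    Summable fun p : negQuadrant => term a b c x y q p

/-- The Hecke-type double-sum of type I symmetry,
`f_{a,b,c}(x, y; q) = (∑_{r,s ≥ 0} - ∑_{r,s < 0}) (-1)^(r+s) x^r y^s q^(a r(r-1)/2 + b r s + c s(s-1)/2)`. -/
def f (a b c : ℤ) (x y q : ℂ) : ℂ :=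
  (∑' p : nonnegQuadrant, term a b c x y q p) - ∑' p : negQuadrant, term a b c x y q p

end HeckeDoubleSum

end

noncomputable section

open Filter Topology

namespace HeckeDoubleSum

/-! ### Infinite products -/

/-! With Q = q² the general term is (-1)^(r+s) Q^(r²+6rs+s²), which is invariant under (r,s) ↦
(-r,-s). The negative quadrant therefore cancels the part r,s ≥ 1 of the other one, and the two
half-axes that remain combine into ∑_{n∈ℤ} (-1)^n Q^(n²) (`f_one_three_one`). The Jacobi triple
product (`tsum_zpow_mul_zpow_sq`) at z = -1 turns this into j(q²;q⁴); it is the limit of a finite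
version proved by induction (`qFact_mul_tsum_tripleTerm`). Elementary product manipulations
(`j_sqrt_eq`), valid for either square root of q, give the other forms. -/

theorem tendsto_prod_qPochInf (x : ℂ) {q : ℂ} (hq : ‖q‖ < 1) :
    Tendsto (fun n : ℕ => ∏ i ∈ Finset.range n, (1 - q ^ i * x)) atTop (𝓝 (qPochInf x q)) :=
  (multipliable_qPochInf x hq).tendsto_prod_tprod_nat

theorem norm_sq_lt_one {q : ℂ} (hq : ‖q‖ < 1) : ‖q ^ 2‖ < 1 := by
  rw [norm_pow]
  exact pow_lt_one₀ (norm_nonneg q) hq two_ne_zero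

theorem qPochInf_mul_neg (x : ℂ) {q : ℂ} (hq : ‖q‖ < 1) :
    qPochInf x q * qPochInf (-x) q = qPochInf (x ^ 2) (q ^ 2) := by
  unfold qPochInf
  rw [← (multipliable_qPochInf x hq).tprod_mul (multipliable_qPochInf (-x) hq)]
  exact tprod_congr fun i => by ring

theorem qPochInf_eq_even_mul_odd (x : ℂ) {q : ℂ} (hq : ‖q‖ < 1) :
    qPochInf x q = qPochInf x (q ^ 2) * qPochInf (q * x) (q ^ 2) := by
  have h (i : ℕ) : 1 - (q ^ 2) ^ i * x = 1 - q ^ (2 * i) * x := by ring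
  have h' (i : ℕ) : 1 - (q ^ 2) ^ i * (q * x) = 1 - q ^ (2 * i + 1) * x := by ring
  have h1 := multipliable_qPochInf x (norm_sq_lt_one hq)
  have h2 := multipliable_qPochInf (q * x) (norm_sq_lt_one hq)
  unfold qPochInf
  simp only [h, h'] at h1 h2 ⊢
  exact (tprod_even_mul_odd (f := fun i => 1 - q ^ i * x) h1 h2).symm

theorem one_sub_pow_succ_ne_zero {p : ℂ} (hp : ‖p‖ < 1) (i : ℕ) : 1 - p ^ i * p ≠ 0 := by
  intro h
  have h1 : ‖p ^ (i + 1)‖ = 1 := by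
    rw [pow_succ, ← sub_eq_zero.mp h, norm_one]
  rw [norm_pow] at h1
  exact (pow_lt_one₀ (norm_nonneg p) hp i.succ_ne_zero).ne h1

theorem qPochInf_self_ne_zero {p : ℂ} (hp : ‖p‖ < 1) : qPochInf p p ≠ 0 := by
  have h : Summable fun i : ℕ => ‖-(p ^ i * p)‖ := by
    simp only [norm_neg, norm_mul, norm_pow]
    exact (summable_geometric_of_lt_one (norm_nonneg p) hp).mul_right _
  have := tprod_one_add_ne_zero_of_summable (f := fun i : ℕ => -(p ^ i * p))
    (fun i => by simpa [← sub_eq_add_neg] using one_sub_pow_succ_ne_zero hp i) h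
  simpa only [qPochInf, ← sub_eq_add_neg] using this

/-! ### The Jacobi triple product -/

/-- The finite product `(p; p)_n`. -/
def qFact (p : ℂ) (n : ℕ) : ℂ := ∏ i ∈ Finset.range n, (1 - p ^ i * p)

/-- The reciprocal of `(p; p)_m`, extended by zero to negative `m`. -/
def qFactInv (p : ℂ) (m : ℤ) : ℂ := if 0 ≤ m then (qFact p m.toNat)⁻¹ else 0

theorem qFact_succ (p : ℂ) (n : ℕ) : qFact p (n + 1) = qFact p n * (1 - p ^ (n + 1)) := by
  rw [qFact, Finset.prod_range_succ, ← pow_succ, qFact]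

theorem qFactInv_natCast (p : ℂ) (n : ℕ) : qFactInv p n = (qFact p n)⁻¹ := by
  simp [qFactInv]

theorem qFactInv_of_neg (p : ℂ) {m : ℤ} (hm : m < 0) : qFactInv p m = 0 := by
  simp [qFactInv, hm]

/-- The extension by zero makes this recurrence hold without boundary cases: at m = 0 the factor 1 -
p^0 vanishes. -/
theorem qFactInv_sub_one {p : ℂ} (hp : ‖p‖ < 1) (m : ℤ) :
    qFactInv p (m - 1) = (1 - p ^ m) * qFactInv p m := by
  rcases lt_trichotomy m 0 with hm | rfl | hm
  · rw [qFactInv_of_neg p hm, qFactInv_of_neg p (by omega), mul_zero]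
  · rw [qFactInv_of_neg p (by omega), zpow_zero, sub_self, zero_mul]
  · obtain ⟨n, rfl⟩ : ∃ n : ℕ, m = (n + 1 : ℕ) := ⟨(m - 1).toNat, by omega⟩
    have h : 1 - p ^ (n + 1) ≠ 0 := by simpa [pow_succ] using one_sub_pow_succ_ne_zero hp n
    rw [qFactInv_natCast, qFact_succ, mul_inv, zpow_natCast, mul_left_comm, mul_inv_cancel₀ h,
      mul_one, ← qFactInv_natCast]
    congr 1
    push_cast
    ring

theorem tendsto_qFact {p : ℂ} (hp : ‖p‖ < 1) : Tendsto (qFact p) atTop (𝓝 (qPochInf p p)) :=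
  tendsto_prod_qPochInf p hp

theorem tendsto_qFactInv {p : ℂ} (hp : ‖p‖ < 1) :
    Tendsto (qFactInv p) atTop (𝓝 (qPochInf p p)⁻¹) := by
  have hN : Tendsto Int.toNat atTop atTop :=
    tendsto_atTop.mpr fun n => (eventually_ge_atTop (n : ℤ)).mono fun m hm => by omega
  have h := ((tendsto_qFact hp).inv₀ (qPochInf_self_ne_zero hp)).comp hN
  refine h.congr' ?_
  filter_upwards [eventually_ge_atTop 0] with m hm
  simp [qFactInv, hm]

theorem exists_norm_qFactInv_le {p : ℂ} (hp : ‖p‖ < 1) : ∃ C, ∀ m, ‖qFactInv p m‖ ≤ C := by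
  obtain ⟨C, hC⟩ := (((tendsto_qFact hp).inv₀ (qPochInf_self_ne_zero hp)).norm).bddAbove_range
  refine ⟨C, fun m => ?_⟩
  have hC' (n : ℕ) : ‖(qFact p n)⁻¹‖ ≤ C := hC ⟨n, rfl⟩
  unfold qFactInv
  split_ifs
  · exact hC' _
  · rw [norm_zero]
    exact (norm_nonneg _).trans (hC' 0)

theorem summable_zpow_mul_zpow_sq {q z : ℂ} (hq0 : q ≠ 0) (hq : ‖q‖ < 1) (hz : z ≠ 0) :
    Summable fun n : ℤ => z ^ n * q ^ (n ^ 2) := by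
  have hpi : (Real.pi : ℂ) ≠ 0 := by exact_mod_cast Real.pi_ne_zero
  have h := (summable_jacobiTheta₂_term_iff (Complex.log z / (2 * Real.pi * Complex.I))
    (Complex.log q / (Real.pi * Complex.I))).mpr (by
      have h1 : Complex.log q / (Real.pi * Complex.I)
          = ((-1 / Real.pi : ℝ) : ℂ) * (Complex.log q * Complex.I) := by
        rw [div_eq_iff (mul_ne_zero hpi Complex.I_ne_zero)]
        push_cast
        field_simp
        rw [Complex.I_sq]
        ring
      -- The theta parameter τ has Im τ = -log‖q‖/π, positive since ‖q‖ < 1.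
      rw [h1, Complex.im_ofReal_mul, Complex.mul_I_im, Complex.log_re]
      exact mul_pos_of_neg_of_neg (div_neg_of_neg_of_pos (by norm_num) Real.pi_pos)
        (Real.log_neg (norm_pos_iff.mpr hq0) hq))
  refine h.congr fun n => ?_
  rw [jacobiTheta₂_term, Complex.exp_add]
  conv_rhs => rw [← Complex.exp_log hz, ← Complex.exp_log hq0]
  rw [← Complex.exp_int_mul, ← Complex.exp_int_mul]
  congr 2
  · field_simp
  · push_cast
    field_simp

/-- The `n`-th term of the finite form of the Jacobi triple product. -/
def tripleTerm (z q : ℂ) (N : ℕ) (n : ℤ) : ℂ :=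
  z ^ n * q ^ (n ^ 2) * (qFactInv (q ^ 2) (N - n) * qFactInv (q ^ 2) (N + n))

theorem exists_norm_tripleTerm_le {q : ℂ} (z : ℂ) (hq : ‖q‖ < 1) :
    ∃ C, ∀ N n, ‖tripleTerm z q N n‖ ≤ ‖z ^ n * q ^ (n ^ 2)‖ * C := by
  obtain ⟨C, hC⟩ := exists_norm_qFactInv_le (norm_sq_lt_one hq)
  refine ⟨C * C, fun N n => ?_⟩
  rw [tripleTerm, norm_mul, norm_mul (qFactInv _ _)]
  have h0 : 0 ≤ C := (norm_nonneg _).trans (hC 0)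
  gcongr <;> exact hC _

theorem summable_tripleTerm {q z : ℂ} (hq0 : q ≠ 0) (hq : ‖q‖ < 1) (hz : z ≠ 0) (N : ℕ) :
    Summable (tripleTerm z q N) := by
  obtain ⟨C, hC⟩ := exists_norm_tripleTerm_le z hq
  exact ((summable_zpow_mul_zpow_sq hq0 hq hz).norm.mul_right C).of_norm_bounded (hC N)

/-- In terms of X = p^(N+1-n) and Y = p^(N+1+n), p = q², all four terms share the factor z^n q^(n²)
and the two reciprocals at level N + 1; what is left is a polynomial identity in X, Y and 1/p. -/
theorem tripleTerm_succ {q z : ℂ} (hq0 : q ≠ 0) (hq : ‖q‖ < 1) (hz : z ≠ 0) (N : ℕ) (n : ℤ) :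
    (1 - (q ^ 2) ^ (2 * N + 1)) * (1 - (q ^ 2) ^ (2 * N + 2)) * tripleTerm z q (N + 1) n =
      (1 + (q ^ 2) ^ (2 * N + 1)) * tripleTerm z q N n
        + z * q ^ (2 * N + 1) * tripleTerm z q N (n - 1)
        + z⁻¹ * q ^ (2 * N + 1) * tripleTerm z q N (n + 1) := by
  have hp := norm_sq_lt_one hq
  have hp0 : q ^ 2 ≠ 0 := pow_ne_zero 2 hq0
  set p := q ^ 2 with hpq
  set X := p ^ ((N : ℤ) + 1 - n) with hX
  set Y := p ^ ((N : ℤ) + 1 + n) with hY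
  have e1 : qFactInv p (N - n) = (1 - X) * qFactInv p (N + 1 - n) := by
    rw [hX, ← qFactInv_sub_one hp]; congr 1; ring
  have e2 : qFactInv p (N + n) = (1 - Y) * qFactInv p (N + 1 + n) := by
    rw [hY, ← qFactInv_sub_one hp]; congr 1; ring
  have e3 : qFactInv p (N + (n - 1)) = (1 - Y / p) * qFactInv p (N + n) := by
    rw [hY, div_eq_mul_inv, ← zpow_sub_one₀ hp0, show (N : ℤ) + (n - 1) = N + n - 1 by ring, qFactInv_sub_one hp]
    congr 3; ring
  have e4 : qFactInv p (N - (n + 1)) = (1 - X / p) * qFactInv p (N - n) := by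
    rw [hX, div_eq_mul_inv, ← zpow_sub_one₀ hp0, show (N : ℤ) - (n + 1) = N - n - 1 by ring, qFactInv_sub_one hp]
    congr 3; ring
  have hXY : p ^ (2 * N + 2) = X * Y := by
    rw [hX, hY, ← zpow_add₀ hp0, ← zpow_natCast]
    congr 1; push_cast; ring
  have hXY' : p ^ (2 * N + 1) = X * Y / p := by
    rw [← hXY, pow_succ p (2 * N + 1), mul_div_cancel_right₀ _ hp0]
  -- Shifting n costs a power of p: (n-1)² + 2N + 1 = n² + 2(N+1-n).
  have f1 : z * q ^ (2 * N + 1) * (z ^ (n - 1) * q ^ ((n - 1) ^ 2)) = z ^ n * q ^ n ^ 2 * X := by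
    rw [hX, hpq, zpow_sub_one₀ hz, ← zpow_natCast q 2, ← zpow_mul, ← zpow_natCast q (2 * N + 1)]
    rw [show z * q ^ ((2 * N + 1 : ℕ) : ℤ) * (z ^ n * z⁻¹ * q ^ ((n - 1) ^ 2))
      = (z * z⁻¹) * z ^ n * (q ^ ((2 * N + 1 : ℕ) : ℤ) * q ^ ((n - 1) ^ 2)) by ring,
      mul_inv_cancel₀ hz, one_mul, mul_assoc, ← zpow_add₀ hq0, ← zpow_add₀ hq0]
    congr 2; push_cast; ring
  have f2 : z⁻¹ * q ^ (2 * N + 1) * (z ^ (n + 1) * q ^ ((n + 1) ^ 2)) = z ^ n * q ^ n ^ 2 * Y := by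
    rw [hY, hpq, zpow_add_one₀ hz, ← zpow_natCast q 2, ← zpow_mul, ← zpow_natCast q (2 * N + 1)]
    rw [show z⁻¹ * q ^ ((2 * N + 1 : ℕ) : ℤ) * (z ^ n * z * q ^ ((n + 1) ^ 2))
      = (z * z⁻¹) * z ^ n * (q ^ ((2 * N + 1 : ℕ) : ℤ) * q ^ ((n + 1) ^ 2)) by ring,
      mul_inv_cancel₀ hz, one_mul, mul_assoc, ← zpow_add₀ hq0, ← zpow_add₀ hq0]
    congr 2; push_cast; ring
  simp only [tripleTerm, ← hpq]
  rw [← mul_assoc (z * q ^ (2 * N + 1)), f1, ← mul_assoc (z⁻¹ * q ^ (2 * N + 1)), f2, e3, e4,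
    show (N : ℤ) - (n - 1) = N + 1 - n by ring, show (N : ℤ) + (n + 1) = N + 1 + n by ring,
    e1, e2, hXY', hXY]
  push_cast
  field_simp
  ring

theorem tsum_tripleTerm_succ {q z : ℂ} (hq0 : q ≠ 0) (hq : ‖q‖ < 1) (hz : z ≠ 0) (N : ℕ) :
    (1 - (q ^ 2) ^ (2 * N + 1)) * (1 - (q ^ 2) ^ (2 * N + 2)) * ∑' n, tripleTerm z q (N + 1) n =
      (1 + z * q ^ (2 * N + 1)) * (1 + z⁻¹ * q ^ (2 * N + 1)) * ∑' n, tripleTerm z q N n := by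
  have h := (summable_tripleTerm hq0 hq hz N).hasSum
  have h1 := (Equiv.subRight (1 : ℤ)).hasSum_iff.mpr h
  have h2 := (Equiv.addRight (1 : ℤ)).hasSum_iff.mpr h
  have h3 := ((h.mul_left (1 + (q ^ 2) ^ (2 * N + 1))).add
    (h1.mul_left (z * q ^ (2 * N + 1)))).add (h2.mul_left (z⁻¹ * q ^ (2 * N + 1)))
  rw [← tsum_mul_left]
  simp only [tripleTerm_succ hq0 hq hz]
  refine h3.tsum_eq.trans ?_
  -- The three coefficients factor because (q²)^(2N+1) = (q^(2N+1))².
  field_simp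
  ring

theorem qFact_mul_tsum_tripleTerm {q z : ℂ} (hq0 : q ≠ 0) (hq : ‖q‖ < 1) (hz : z ≠ 0) (N : ℕ) :
    qFact (q ^ 2) (2 * N) * ∑' n, tripleTerm z q N n =
      (∏ k ∈ Finset.range N, (1 - (q ^ 2) ^ k * (-(z * q)))) *
        ∏ k ∈ Finset.range N, (1 - (q ^ 2) ^ k * (q ^ 2 / -(z * q))) := by
  induction N with
  | zero =>
    -- At N = 0 one of ±n is negative unless n = 0, so a single term survives.
    rw [tsum_eq_single 0]
    · simp [tripleTerm, qFactInv, qFact]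
    · intro n hn
      rcases hn.lt_or_gt with hn | hn
      · simp [tripleTerm, qFactInv_of_neg _ hn]
      · simp [tripleTerm, qFactInv_of_neg _ (neg_neg_of_pos hn)]
  | succ N ih =>
    rw [show 2 * (N + 1) = 2 * N + 1 + 1 by ring, qFact_succ, qFact_succ, mul_assoc, mul_assoc,
      ← mul_assoc (1 - _), tsum_tripleTerm_succ hq0 hq hz, mul_left_comm, ih,
      Finset.prod_range_succ, Finset.prod_range_succ]
    have h1 : 1 + z * q ^ (2 * N + 1) = 1 - (q ^ 2) ^ N * (-(z * q)) := by ring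
    have h2 : 1 + z⁻¹ * q ^ (2 * N + 1) = 1 - (q ^ 2) ^ N * (q ^ 2 / -(z * q)) := by
      field_simp
      ring
    rw [h1, h2]
    ring

/-- The **Jacobi triple product identity**. -/
theorem tsum_zpow_mul_zpow_sq {q z : ℂ} (hq0 : q ≠ 0) (hq : ‖q‖ < 1) (hz : z ≠ 0) :
    ∑' n : ℤ, z ^ n * q ^ (n ^ 2) = j (-(z * q)) (q ^ 2) := by
  have hp := norm_sq_lt_one hq
  have hL := qPochInf_self_ne_zero hp
  set L := qPochInf (q ^ 2) (q ^ 2) with hLdef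
  obtain ⟨C, hC⟩ := exists_norm_tripleTerm_le z hq
  have hlim : Tendsto (fun N => ∑' n, tripleTerm z q N n) atTop
      (𝓝 (∑' n : ℤ, z ^ n * q ^ (n ^ 2) * (L⁻¹ * L⁻¹))) := by
    -- The reciprocals are bounded uniformly in N and n, so a multiple of the theta series
    -- dominates.
    refine tendsto_tsum_of_dominated_convergence
      ((summable_zpow_mul_zpow_sq hq0 hq hz).norm.mul_right C) (fun n => ?_)
      (Eventually.of_forall hC)
    refine Tendsto.const_mul _ (((tendsto_qFactInv hp).comp ?_).mul
      ((tendsto_qFactInv hp).comp ?_))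
    · exact tendsto_atTop_add_const_right _ (-n) tendsto_natCast_atTop_atTop
    · exact tendsto_atTop_add_const_right _ n tendsto_natCast_atTop_atTop
  have h2 : Tendsto (fun N => qFact (q ^ 2) (2 * N)) atTop (𝓝 L) :=
    (tendsto_qFact hp).comp (tendsto_id.const_mul_atTop' two_pos)
  have h3 := (tendsto_prod_qPochInf (-(z * q)) hp).mul
    (tendsto_prod_qPochInf (q ^ 2 / -(z * q)) hp)
  simp only [← qFact_mul_tsum_tripleTerm hq0 hq hz] at h3
  have h4 := tendsto_nhds_unique (h2.mul hlim) h3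
  rw [tsum_mul_right] at h4
  rw [j, ← h4, ← hLdef]
  field_simp

/-! ### The double sum -/

theorem term_one_three_one {q : ℂ} (hq0 : q ≠ 0) (p : ℤ × ℤ) :
    term 1 3 1 (q ^ 2) (q ^ 2) (q ^ 4) p =
      (-1) ^ (p.1 + p.2) * (q ^ 2) ^ (p.1 ^ 2 + 6 * p.1 * p.2 + p.2 ^ 2) := by
  have hp0 : q ^ 2 ≠ 0 := pow_ne_zero 2 hq0
  have h4 : q ^ 4 = (q ^ 2) ^ (2 : ℤ) := by
    rw [zpow_ofNat]; ring
  rw [term, h4, ← zpow_mul, mul_assoc, mul_assoc, ← zpow_add₀ hp0, ← zpow_add₀ hp0]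
  congr 2
  linear_combination two_mul_choose2 p.1 + two_mul_choose2 p.2

/-- The pairs of natural numbers as the quadrant `r, s ≥ 0`. -/
def nonnegQuadrantEquiv : ℕ × ℕ ≃ nonnegQuadrant where
  toFun p := ⟨(p.1, p.2), by simp [nonnegQuadrant]⟩
  invFun p := (p.1.1.toNat, p.1.2.toNat)
  left_inv p := by simp
  right_inv := by
    rintro ⟨⟨r, s⟩, hr, hs⟩
    simp_all

/-- The pairs of natural numbers as the quadrant `r, s < 0`. -/
def negQuadrantEquiv : ℕ × ℕ ≃ negQuadrant where
  toFun p := ⟨(-((p.1 + 1 : ℕ) : ℤ), -((p.2 + 1 : ℕ) : ℤ)), by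
    simp only [negQuadrant, Set.mem_ofPred_eq]; omega⟩
  invFun p := ((-p.1.1 - 1).toNat, (-p.1.2 - 1).toNat)
  left_inv p := by simp
  right_inv := by
    rintro ⟨⟨r, s⟩, hr, hs⟩
    ext <;> simp at * <;> omega

/-- The term `(-1)^(a+b) Q^(a² + 6ab + b²)` of the double sum. -/
def quadTerm (Q : ℂ) (p : ℕ × ℕ) : ℂ :=
  (-1) ^ (p.1 + p.2) * Q ^ (p.1 ^ 2 + 6 * p.1 * p.2 + p.2 ^ 2)

theorem term_nonnegQuadrantEquiv {q : ℂ} (hq0 : q ≠ 0) (p : ℕ × ℕ) :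
    term 1 3 1 (q ^ 2) (q ^ 2) (q ^ 4) (nonnegQuadrantEquiv p) = quadTerm (q ^ 2) p := by
  rw [term_one_three_one hq0, quadTerm, ← zpow_natCast (-1 : ℂ), ← zpow_natCast (q ^ 2)]
  simp [nonnegQuadrantEquiv]

theorem term_negQuadrantEquiv {q : ℂ} (hq0 : q ≠ 0) (p : ℕ × ℕ) :
    term 1 3 1 (q ^ 2) (q ^ 2) (q ^ 4) (negQuadrantEquiv p) =
      quadTerm (q ^ 2) (p.1 + 1, p.2 + 1) := by
  have h : (-1 : ℂ) ^ (-((p.1 + 1 : ℕ) : ℤ) + -((p.2 + 1 : ℕ) : ℤ))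
      = (-1) ^ ((p.1 + 1) + (p.2 + 1)) := by
    rw [← neg_add, zpow_neg, ← inv_zpow, inv_neg_one, ← Nat.cast_add, zpow_natCast]
  rw [term_one_three_one hq0, quadTerm, ← zpow_natCast (q ^ 2)]
  simp only [negQuadrantEquiv, Equiv.coe_fn_mk, h]
  congr 2

theorem summable_quadTerm {Q : ℂ} (hQ : ‖Q‖ < 1) : Summable (quadTerm Q) := by
  have hg := summable_geometric_of_lt_one (norm_nonneg Q) hQ
  refine (hg.mul_of_nonneg hg (fun _ => by positivity) (fun _ => by positivity)).of_norm_bounded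
    fun p => ?_
  rw [quadTerm, norm_mul, norm_pow, norm_neg, norm_one, one_pow, one_mul, norm_pow, ← pow_add]
  refine pow_le_pow_of_le_one (norm_nonneg Q) hQ.le ?_
  -- a² + 6ab + b² ≥ a + b, so a product of geometric series dominates.
  nlinarith [Nat.le_self_pow two_ne_zero p.1, Nat.le_self_pow two_ne_zero p.2]

theorem converges_one_three_one {q : ℂ} (hq0 : q ≠ 0) (hq : ‖q‖ < 1) :
    Converges 1 3 1 (q ^ 2) (q ^ 2) (q ^ 4) := by
  have h := summable_quadTerm (norm_sq_lt_one hq)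
  constructor
  · rw [← nonnegQuadrantEquiv.summable_iff]
    exact h.congr fun p => (term_nonnegQuadrantEquiv hq0 p).symm
  · rw [← negQuadrantEquiv.summable_iff]
    have hinj : Function.Injective fun p : ℕ × ℕ => (p.1 + 1, p.2 + 1) := fun a b hab => by
      simpa [Prod.ext_iff] using hab
    exact (h.comp_injective hinj).congr fun p => (term_negQuadrantEquiv hq0 p).symm

/-- Removing the axes from the first quadrant leaves the shifted quadrant. -/
theorem tsum_prod_nat_eq_axes_add {g : ℕ × ℕ → ℂ} (hg : Summable g) :
    ∑' p, g p = (∑' s, g (0, s)) + (∑' r, g (r + 1, 0)) + ∑' p : ℕ × ℕ, g (p.1 + 1, p.2 + 1) := by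
  have hinj : Function.Injective fun p : ℕ × ℕ => (p.1 + 1, p.2 + 1) := fun a b hab => by
    simpa [Prod.ext_iff] using hab
  have hinj' : Function.Injective fun r : ℕ => (r + 1, 0) := fun a b hab => by
    simpa [Prod.ext_iff] using hab
  have hg' : Summable fun p : ℕ × ℕ => g (p.1 + 1, p.2 + 1) := hg.comp_injective hinj
  have hg0 : Summable fun r : ℕ => g (r + 1, 0) := hg.comp_injective hinj'
  rw [hg.tsum_prod, hg.prod.tsum_eq_zero_add, hg'.tsum_prod, add_assoc, ← hg0.tsum_add hg'.prod]
  congr 1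
  exact tsum_congr fun r => (hg.prod_factor (r + 1)).tsum_eq_zero_add

theorem f_one_three_one {q : ℂ} (hq0 : q ≠ 0) (hq : ‖q‖ < 1) :
    f 1 3 1 (q ^ 2) (q ^ 2) (q ^ 4) = ∑' n : ℤ, (-1) ^ n * (q ^ 2) ^ (n ^ 2) := by
  have hg := summable_quadTerm (norm_sq_lt_one hq)
  have h1 (n : ℕ) : (-1) ^ (n : ℤ) * (q ^ 2) ^ ((n : ℤ) ^ 2) = quadTerm (q ^ 2) (0, n) := by
    rw [quadTerm, ← zpow_natCast (-1 : ℂ), ← zpow_natCast (q ^ 2)]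
    simp
  have h2 (n : ℕ) : (-1) ^ (-((n : ℤ) + 1)) * (q ^ 2) ^ ((-((n : ℤ) + 1)) ^ 2) =
      quadTerm (q ^ 2) (n + 1, 0) := by
    rw [quadTerm, zpow_neg, ← inv_zpow, inv_neg_one, neg_sq, ← zpow_natCast (-1 : ℂ),
      ← zpow_natCast (q ^ 2)]
    simp
  have hs1 : Summable fun n : ℕ => quadTerm (q ^ 2) (0, n) :=
    hg.comp_injective fun a b hab => by simpa using hab
  have hs2 : Summable fun n : ℕ => quadTerm (q ^ 2) (n + 1, 0) :=
    hg.comp_injective fun a b hab => by simpa using hab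
  simp only [← h1] at hs1
  simp only [← h2] at hs2
  rw [(hs1.hasSum.of_nat_of_neg_add_one (f := fun n : ℤ => (-1 : ℂ) ^ n * (q ^ 2) ^ (n ^ 2))
    hs2.hasSum).tsum_eq]
  simp only [h1, h2]
  rw [f, ← nonnegQuadrantEquiv.tsum_eq, ← negQuadrantEquiv.tsum_eq]
  simp only [term_nonnegQuadrantEquiv hq0, term_negQuadrantEquiv hq0]
  rw [tsum_prod_nat_eq_axes_add hg, add_sub_cancel_right]

/-! ### Product identities for theta functions -/

/-- As -q/t = -t, pairing ±t and splitting (-q;-q)_∞ by parity turns the left side into (q;q²)_∞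
(-q;q²)_∞ (q²;q²)_∞. Pairing ±q and splitting (q²;q²)_∞ then gives (q²;q⁴)_∞² (q⁴;q⁴)_∞. -/
theorem j_sqrt_eq {q t : ℂ} (hq0 : q ≠ 0) (hq : ‖q‖ < 1) (ht : t ^ 2 = q) :
    j t (-q) = j (q ^ 2) (q ^ 4) := by
  have ht0 : t ≠ 0 := by
    rintro rfl
    exact hq0 (by rw [← ht]; simp)
  have hnq : ‖-q‖ < 1 := by rwa [norm_neg]
  have h4 : q ^ 4 = (q ^ 2) ^ 2 := by ring
  have e1 : -q / t = -t := by
    rw [← ht]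
    field_simp
  have e2 : q ^ 4 / q ^ 2 = q ^ 2 := by
    field_simp
  have e3 := qPochInf_mul_neg t hnq
  have e4 := qPochInf_eq_even_mul_odd (-q) hnq
  have e5 := qPochInf_mul_neg q (norm_sq_lt_one hq)
  have e6 := qPochInf_eq_even_mul_odd (q ^ 2) (norm_sq_lt_one hq)
  rw [neg_sq] at e3 e4
  rw [ht] at e3
  rw [neg_mul_neg, ← sq] at e4
  rw [← h4] at e5
  rw [← sq, ← h4] at e6
  rw [j, j, e1, e2, e3, e4, ← mul_assoc, e5, e6, mul_assoc]

end HeckeDoubleSum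

end

/-- Here `t` is an arbitrary choice of the square root `q ^ (1 / 2)`. -/
theorem mainTheorem3 (q t : ℂ) (hq0 : q ≠ 0) (hq1 : ‖q‖ < 1) (ht : t ^ 2 = q) :
    HeckeDoubleSum.Converges 1 3 1 (q ^ 2) (q ^ 2) (q ^ 4) ∧
      HeckeDoubleSum.f 1 3 1 (q ^ 2) (q ^ 2) (q ^ 4) = HeckeDoubleSum.j t (-q) ∧
      HeckeDoubleSum.j t (-q) = HeckeDoubleSum.j (-t) (-q) ∧
      HeckeDoubleSum.j (-t) (-q) = HeckeDoubleSum.j (q ^ 2) (q ^ 4) := by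
  have hj := HeckeDoubleSum.j_sqrt_eq hq0 hq1 ht
  have hj' := HeckeDoubleSum.j_sqrt_eq hq0 hq1 ((neg_sq t).trans ht)
  refine ⟨HeckeDoubleSum.converges_one_three_one hq0 hq1, ?_, hj.trans hj'.symm, hj'⟩
  rw [hj, HeckeDoubleSum.f_one_three_one hq0 hq1,
    HeckeDoubleSum.tsum_zpow_mul_zpow_sq (pow_ne_zero 2 hq0) (HeckeDoubleSum.norm_sq_lt_one hq1)
      (neg_ne_zero.mpr one_ne_zero)]
  congr 1 <;> ring
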